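/- Let $\mu$ be a probability law on $\mathbb{C}$ with $\int |z|\,d\mu(z)<\infty$, $\int z\,d\mu(z)=0$ and $\mu\neq\delta_0$, and let $W_1,W_2,\dots$ be i.i.d. random variables with law $\mu$; write $W$ for a generic one of them. Arguments are taken in $[0,2\pi)$, with $\arg 0=0$. For $n\ge 1$ let $\hat W=(\hat W_1,\dots,\hat W_n)$ be the list $(W_1,\dots,W_n)$ sorted by non-decreasing argument, where terms with the same argument may be put in any order (in particular, in uniform random order). Let $S(k)=\sum_{j=1}^k \hat W_j$ for $0\le k\le n$, interpolated linearly between consecutive integers, let $\mathbf{B}_n=\{S(t): t\in[0,n]\}$ be the resulting polygonal line, and for $\theta\in[0,2\pi)$ let $N_n(\theta)=\#\{i\le n:\arg(W_i)\le\theta\}$. Let $\mathbb{P}_{\arg}$ be the law of $\arg W$, let $m_x$ be the mean of the conditional law of $|W|$ given $\arg W=x$, and let $\nu=\mathsf{K}(\mu)$ be the measure on $[0,2\pi)$ given by $$d\nu(x)=\frac{m_x}{\mathbb{E}|W|}\,d\mathbb{P}_{\arg}(x).$$ Let $F_\nu(x)=\nu([0,x])$ and $F_\nu^{-1}(y)=\inf\{x\ge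 0: F_\nu(x)\ge y\}$. For $t\in[0,1]$ put $$Z_\nu(t)=\int_0^t \exp\bigl(iF_\nu^{-1}(u)\bigr)\,du,\qquad \mathcal{B}_\nu=\{Z_\nu(t):t\in[0,1]\}.$$ Theorem. With $d_H$ the Hausdorff distance, 1. $d_H\bigl(\mathbf{B}_n/(n\,\mathbb{E}|W|),\ \mathcal{B}_\nu\bigr)\to 0$ almost surely as $n\to\infty$; 2. for every $\theta\in[0,2\pi)$, almost surely as $n\to\infty$, $$\frac{S(N_n(\theta))}{n\,\mathbb{E}|W|}\ \longrightarrow\ \int_{[0,\theta]}e^{it}\,d\nu(t)=Z_\nu(F_\nu(\theta)).$$ -/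

import Mathlib

open MeasureTheory ProbabilityTheory Filter Topology Set
open scoped Pointwise

noncomputable section

namespace SortedPolygon

/-- The argument of a complex number, taken in `[0, 2π)` (with the convention `arg 0 = 0`). -/
def argPos (z : ℂ) : ℝ := if 0 ≤ z.arg then z.arg else z.arg + 2 * Real.pi

/-! ### The curve of a measure on the circle

A measure on the circle `ℝ/2πℤ` is represented as a measure on `ℝ` carried by `[0, 2π)`. -/

/-- The cumulative distribution function `F_ν(x) = ν([0, x])`. -/
def circleCdf (ν : Measure ℝ) (x : ℝ) : ℝ := ν.real (Icc 0 x)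

/-- The generalised inverse `F_ν⁻¹(y) = inf {x ≥ 0 : F_ν(x) ≥ y}`. -/
def circleQuantile (ν : Measure ℝ) (y : ℝ) : ℝ := sInf {x : ℝ | 0 ≤ x ∧ y ≤ circleCdf ν x}

/-- The curve `Z_ν(t) = ∫₀ᵗ exp(i F_ν⁻¹(u)) du`. -/
def curveZ (ν : Measure ℝ) (t : ℝ) : ℂ :=
  ∫ u in (0 : ℝ)..t, Complex.exp (Complex.I * (circleQuantile ν u : ℂ))

/-- The range `B_ν` of `Z_ν` on `[0, 1]`. -/
def curveB (ν : Measure ℝ) : Set ℂ := curveZ ν '' Icc 0 1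

/-! ### The map `K` from laws on `ℂ` to measures on the circle -/

/-- The mean modulus `E|W|` of a random variable `W` with law `μ`. -/
def meanModulus (μ : Measure ℂ) : ℝ := ∫ z, ‖z‖ ∂μ

/-- `m_x`: the mean of the conditional law of `|W|` given `arg W = x`, for `W` with law `μ`. -/
def condMeanModulus (μ : Measure ℂ) [IsFiniteMeasure μ] (x : ℝ) : ℝ :=
  ∫ r, r ∂(condDistrib (fun z : ℂ => ‖z‖) argPos μ x)

/-- `K(μ)`: the measure with density `m_x / E|W|` with respect to the law of `arg W`. -/
def lawK (μ : Measure ℂ) [IsFiniteMeasure μ] : Measure ℝ :=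
  (μ.map argPos).withDensity
    (fun x => ENNReal.ofReal (condMeanModulus μ x / meanModulus μ))

/-! ### Polygonal lines -/

/-- The partial sum of the first `k` terms of a finite sequence of steps. -/
def partialSum {n : ℕ} (w : Fin n → ℂ) (k : ℕ) : ℂ :=
  ∑ j ∈ Finset.univ.filter (fun j : Fin n => (j : ℕ) < k), w j

/-- The partial sums, linearly interpolated between consecutive integers
(used for `t ∈ [0, n]`). -/
def interpSum {n : ℕ} (w : Fin n → ℂ) (t : ℝ) : ℂ :=
  partialSum w ⌊t⌋₊ + ((t - (⌊t⌋₊ : ℝ) : ℝ) : ℂ) *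
    (partialSum w (⌊t⌋₊ + 1) - partialSum w ⌊t⌋₊)

/-- The polygonal line `{S(t) : t ∈ [0, n]}` with successive steps `w`. -/
def polygonalLine {n : ℕ} (w : Fin n → ℂ) : Set ℂ := interpSum w '' Icc 0 (n : ℝ)

/-- `N_n(θ)`: the number of steps whose argument is at most `θ`. -/
def argCount {n : ℕ} (w : Fin n → ℂ) (θ : ℝ) : ℕ :=
  Nat.card {i : Fin n // argPos (w i) ≤ θ}

/-- `v` is a rearrangement of `w` in non-decreasing order of the arguments (steps with the
same argument may come in any order). -/
def IsArgSorting {n : ℕ} (w v : Fin n → ℂ) : Prop :=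
  (∃ σ : Equiv.Perm (Fin n), ∀ i, v i = w (σ i)) ∧ Monotone (fun i => argPos (v i))

end SortedPolygon

end

noncomputable section

namespace SortedPolygon

/-! Both curves are determined by a cumulative distribution of directions, and they depend
continuously on it. Integrating by parts, `∫₀ˢ exp(i F⁻¹(u)) du = s - ∫₀^{2π} i e^{ix} min(s, F(x))
dx`, because the `u ≤ s` with `F⁻¹(u) ≤ x` fill an interval of length `min(s, F(x))`. The right side
is `arcCurve F s`; it involves no quantile and is Lipschitz in `s` and in `F` for the `L¹` norm
(`norm_arcCurve_sub_le`).

A polygonal line with sorted steps, rescaled by `r = n E|W|`, is also an `arcCurve`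
(`inv_smul_interpSum_eq_arcCurve`), now for the step function `G_n(x) = r⁻¹ ∑ |W_i| 1{arg W_i ≤ x}`,
with `s` the length travelled. Hence the Hausdorff distance is at most a constant times the error in
total length, plus `‖G_n - F_ν‖₁` (`hausdorffDist_polygonalLine_le`).

Under `lawK μ` directions are weighted by modulus, so the strong law gives `G_n(q) → F_ν(q)` at all
rationals `q` and total length tending to `1`; monotonicity and dominated convergence give `L¹`
convergence. For the second claim, `S(N_n(θ))` is the sum of the `W_i` with argument at most `θ`,
and the strong law applies directly. -/

lemma measurable_argPos : Measurable argPos :=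
  Measurable.ite (measurableSet_le measurable_const Complex.measurable_arg)
    Complex.measurable_arg (Complex.measurable_arg.add_const _)

lemma argPos_nonneg (z : ℂ) : 0 ≤ argPos z := by
  unfold argPos
  split_ifs with h
  · exact h
  · linarith [Complex.neg_pi_lt_arg z, Real.pi_pos]

lemma argPos_lt (z : ℂ) : argPos z < 2 * Real.pi := by
  unfold argPos
  split_ifs with h
  · linarith [Complex.arg_le_pi z, Real.pi_pos]
  · linarith

lemma norm_mul_exp_argPos (z : ℂ) :
    (‖z‖ : ℂ) * Complex.exp (Complex.I * (argPos z : ℂ)) = z := by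
  have h : Complex.exp (Complex.I * (argPos z : ℂ)) = Complex.exp (z.arg * Complex.I) := by
    unfold argPos
    split_ifs
    · rw [mul_comm]
    · push_cast
      rw [mul_add, Complex.exp_add, mul_comm Complex.I (2 * (Real.pi : ℂ)),
        Complex.exp_two_pi_mul_I, mul_one, mul_comm]
  rw [h, Complex.norm_mul_exp_arg_mul_I]

/-! ### The measure `lawK μ` through modulus bias -/

lemma meanModulus_nonneg (μ : Measure ℂ) : 0 ≤ meanModulus μ :=
  integral_nonneg fun z => norm_nonneg z

lemma meanModulus_pos {μ : Measure ℂ} [IsProbabilityMeasure μ]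
    (hint : Integrable (fun z : ℂ => z) μ) (hμ : μ ≠ Measure.dirac 0) : 0 < meanModulus μ := by
  refine (meanModulus_nonneg μ).lt_of_ne' fun h => hμ ?_
  have h0 := (integral_eq_zero_iff_of_nonneg (fun z => norm_nonneg z) hint.norm).1 h
  have h1 : (fun z : ℂ => z) =ᵐ[μ] fun _ => (0 : ℂ) := by
    filter_upwards [h0] with z hz using norm_eq_zero.1 hz
  calc μ = μ.map fun z => z := Measure.map_id'.symm
    _ = μ.map fun _ => (0 : ℂ) := Measure.map_congr h1
    _ = Measure.dirac 0 := by simp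

lemma measurable_condMeanModulus (μ : Measure ℂ) [IsFiniteMeasure μ] :
    Measurable (condMeanModulus μ) :=
  (StronglyMeasurable.integral_kernel (κ := condDistrib (fun z : ℂ => ‖z‖) argPos μ)
    stronglyMeasurable_id).measurable

/-- `K(μ)` is the image under the argument of the law `μ` biased by the modulus. -/
lemma lawK_eq_map {μ : Measure ℂ} [IsProbabilityMeasure μ]
    (hint : Integrable (fun z : ℂ => z) μ) :
    lawK μ = (μ.withDensity fun z => ENNReal.ofReal (‖z‖ / meanModulus μ)).map argPos := by
  -- `m_{arg z}` is a version of the conditional expectation of `|z|` given the argument, so the two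
  -- have the same integral over every `argPos ⁻¹' A`.
  have hc : μ[fun z => ‖z‖ | (inferInstance : MeasurableSpace ℝ).comap argPos] =ᵐ[μ]
      fun z => condMeanModulus μ (argPos z) :=
    condExp_ae_eq_integral_condDistrib' measurable_argPos hint.norm
  have hnn : 0 ≤ᵐ[μ] fun z => condMeanModulus μ (argPos z) :=
    (condExp_nonneg (ae_of_all _ fun z => norm_nonneg z)).trans hc.le
  have hci : Integrable (fun z => condMeanModulus μ (argPos z)) μ := integrable_condExp.congr hc
  ext A hA
  have hA' : MeasurableSet (argPos ⁻¹' A) := measurable_argPos hA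
  rw [lawK, withDensity_apply _ hA, Measure.map_apply measurable_argPos hA,
    withDensity_apply _ hA', setLIntegral_map hA
      ((measurable_condMeanModulus μ).div_const _).ennreal_ofReal measurable_argPos,
    ← ofReal_integral_eq_lintegral_ofReal (hci.div_const _).integrableOn,
    ← ofReal_integral_eq_lintegral_ofReal (hint.norm.div_const _).integrableOn,
    integral_div, integral_div,
    ← setIntegral_condExp measurable_argPos.comap_le hint.norm ⟨A, hA, rfl⟩,
    setIntegral_congr_ae hA' (hc.mono fun z hz _ => hz)]
  · exact ae_of_all _ fun z => div_nonneg (norm_nonneg z) (meanModulus_nonneg μ)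
  · filter_upwards [ae_restrict_of_ae hnn] with z hz using div_nonneg hz (meanModulus_nonneg μ)

/-- Integrals against `K(μ)` over `[0, θ]`, in terms of `μ`. -/
lemma setIntegral_lawK {E : Type*} [NormedAddCommGroup E] [NormedSpace ℝ E] {μ : Measure ℂ}
    [IsProbabilityMeasure μ] (hint : Integrable (fun z : ℂ => z) μ) {g : ℝ → E}
    (hg : StronglyMeasurable g) (θ : ℝ) :
    ∫ t in Icc 0 θ, g t ∂(lawK μ) =
      ∫ z, {z | argPos z ≤ θ}.indicator (fun z => (‖z‖ / meanModulus μ) • g (argPos z)) z ∂μ := by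
  have hp : argPos ⁻¹' Icc 0 θ = {z | argPos z ≤ θ} := by
    ext z; simp [argPos_nonneg z]
  have hm : MeasurableSet {z | argPos z ≤ θ} := measurableSet_le measurable_argPos measurable_const
  rw [lawK_eq_map hint, setIntegral_map measurableSet_Icc hg.aestronglyMeasurable
    measurable_argPos.aemeasurable, hp, integral_indicator hm,
    setIntegral_withDensity_eq_setIntegral_toReal_smul (by fun_prop)
      (ae_of_all _ fun z => ENNReal.ofReal_lt_top) _ hm]
  refine integral_congr_ae (ae_of_all _ fun z => ?_)
  simp only [ENNReal.toReal_ofReal (div_nonneg (norm_nonneg z) (meanModulus_nonneg μ))]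

lemma circleCdf_lawK {μ : Measure ℂ} [IsProbabilityMeasure μ]
    (hint : Integrable (fun z : ℂ => z) μ) (θ : ℝ) :
    circleCdf (lawK μ) θ =
      ∫ z, {z | argPos z ≤ θ}.indicator (fun z => ‖z‖ / meanModulus μ) z ∂μ := by
  have h := setIntegral_lawK hint (stronglyMeasurable_const (b := (1 : ℝ))) θ
  simpa [circleCdf] using h

/-- The density `|z|` of the biased law and the direction `e^{i arg z}` multiply back to `z`. -/
lemma setIntegral_exp_lawK {μ : Measure ℂ} [IsProbabilityMeasure μ]
    (hint : Integrable (fun z : ℂ => z) μ) (θ : ℝ) :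
    ∫ t in Icc (0 : ℝ) θ, Complex.exp (Complex.I * (t : ℂ)) ∂(lawK μ) =
      (∫ z, {z | argPos z ≤ θ}.indicator (fun z => z) z ∂μ) / (meanModulus μ : ℂ) := by
  rw [setIntegral_lawK hint (by fun_prop : Continuous _).stronglyMeasurable, ← integral_div]
  refine integral_congr_ae (ae_of_all _ fun z => ?_)
  beta_reduce
  by_cases h : argPos z ≤ θ
  · rw [indicator_of_mem (by exact h), indicator_of_mem (by exact h), Complex.real_smul,
      Complex.ofReal_div, div_mul_eq_mul_div, norm_mul_exp_argPos]
  · simp [indicator, h]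

lemma isProbabilityMeasure_lawK {μ : Measure ℂ} [IsProbabilityMeasure μ]
    (hint : Integrable (fun z : ℂ => z) μ) (hμ : μ ≠ Measure.dirac 0) :
    IsProbabilityMeasure (lawK μ) := by
  constructor
  rw [lawK_eq_map hint, Measure.map_apply measurable_argPos .univ, preimage_univ,
    withDensity_apply _ .univ, setLIntegral_univ, ← ofReal_integral_eq_lintegral_ofReal
      (hint.norm.div_const _)
      (ae_of_all _ fun z => div_nonneg (norm_nonneg z) (meanModulus_nonneg μ)), integral_div]
  change ENNReal.ofReal (meanModulus μ / meanModulus μ) = 1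
  rw [div_self (meanModulus_pos hint hμ).ne', ENNReal.ofReal_one]

lemma lawK_compl_Ico {μ : Measure ℂ} [IsProbabilityMeasure μ]
    (hint : Integrable (fun z : ℂ => z) μ) : lawK μ (Ico 0 (2 * Real.pi))ᶜ = 0 := by
  rw [lawK_eq_map hint, Measure.map_apply measurable_argPos measurableSet_Ico.compl]
  have h : argPos ⁻¹' (Ico 0 (2 * Real.pi))ᶜ = ∅ := by
    ext z
    simp [argPos_nonneg z, argPos_lt z]
  rw [h, measure_empty]

/-! ### Integration by parts -/

/-- The curve with cumulative distribution of directions `G`, parametrised by arc length `s`: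
an integration by parts of `∫₀ˢ exp(i G⁻¹(u)) du`. -/
def arcCurve (G : ℝ → ℝ) (s : ℝ) : ℂ :=
  s - ∫ x in (0 : ℝ)..2 * Real.pi,
    Complex.I * Complex.exp (Complex.I * (x : ℂ)) * (min s (G x) : ℝ)

lemma norm_I_mul_exp (x : ℝ) : ‖Complex.I * Complex.exp (Complex.I * (x : ℂ))‖ = 1 := by
  rw [norm_mul, Complex.norm_I, mul_comm Complex.I (x : ℂ), Complex.norm_exp_ofReal_mul_I, one_mul]

lemma intervalIntegrable_I_mul_exp_mul {h : ℝ → ℝ} {a b : ℝ}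
    (hh : IntervalIntegrable h volume a b) :
    IntervalIntegrable (fun x : ℝ => Complex.I * Complex.exp (Complex.I * (x : ℂ)) * (h x : ℂ))
      volume a b :=
  IntervalIntegrable.continuousOn_mul ⟨Integrable.ofReal hh.1, Integrable.ofReal hh.2⟩ (by fun_prop : Continuous _).continuousOn

lemma intervalIntegrable_indicator_Ici (a b c : ℝ) :
    IntervalIntegrable ((Ici a).indicator fun _ => (1 : ℝ)) volume b c :=
  Monotone.intervalIntegrable (fun x y hxy => by
    by_cases hx : a ≤ x
    · simp [indicator, hx, hx.trans hxy]
    · by_cases hy : a ≤ y <;> simp [indicator, hx, hy])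

/-- The fundamental theorem of calculus on `[a, 2π]`, where `e^{2πi} = 1`. Here `a` enters only
through the indicator of `a ≤ x`, which becomes a distribution function once averaged over `a`. -/
lemma exp_I_mul_eq {a : ℝ} (ha : a ∈ Icc 0 (2 * Real.pi)) :
    Complex.exp (Complex.I * (a : ℂ)) = 1 - ∫ x in (0 : ℝ)..2 * Real.pi,
      Complex.I * Complex.exp (Complex.I * (x : ℂ)) *
        ((Ici a).indicator (fun _ => (1 : ℝ)) x : ℝ) := by
  have hi := fun b c => intervalIntegrable_I_mul_exp_mul (intervalIntegrable_indicator_Ici a b c)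
  have h1 : ∫ x in (0 : ℝ)..a, Complex.I * Complex.exp (Complex.I * (x : ℂ)) *
      ((Ici a).indicator (fun _ => (1 : ℝ)) x : ℝ) = ∫ x in (0 : ℝ)..a, (0 : ℂ) := by
    refine intervalIntegral.integral_congr_ae ?_
    filter_upwards [compl_mem_ae_iff.2 (measure_singleton a)] with x hxa hx
    rw [uIoc_of_le ha.1] at hx
    have : ¬ a ≤ x := not_le.2 (lt_of_le_of_ne hx.2 hxa)
    simp [indicator, this]
  have h2 : ∫ x in a..2 * Real.pi, Complex.I * Complex.exp (Complex.I * (x : ℂ)) *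
      ((Ici a).indicator (fun _ => (1 : ℝ)) x : ℝ) =
      ∫ x in a..2 * Real.pi, Complex.I * Complex.exp (Complex.I * (x : ℂ)) := by
    refine intervalIntegral.integral_congr fun x hx => ?_
    rw [uIcc_of_le ha.2] at hx
    simp [indicator, hx.1]
  have hp : Complex.exp (Complex.I * ((2 * Real.pi : ℝ) : ℂ)) = 1 := by
    push_cast
    rw [mul_comm, Complex.exp_two_pi_mul_I]
  rw [← intervalIntegral.integral_add_adjacent_intervals (hi 0 a) (hi a _), h1, h2,
    intervalIntegral.integral_const_mul, integral_exp_mul_complex Complex.I_ne_zero,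
    intervalIntegral.integral_zero, mul_div_cancel₀ _ Complex.I_ne_zero, hp]
  ring

/-- `exp_I_mul_eq` averaged over `ρ`, with Fubini to exchange the integrals. -/
lemma integral_exp_I_mul {α : Type*} [MeasurableSpace α] (ρ : Measure α) [IsFiniteMeasure ρ]
    {a : α → ℝ} (ha : AEMeasurable a ρ) (har : ∀ᵐ y ∂ρ, a y ∈ Icc 0 (2 * Real.pi)) :
    ∫ y, Complex.exp (Complex.I * (a y : ℂ)) ∂ρ =
      ρ.real univ - ∫ x in (0 : ℝ)..2 * Real.pi,
        Complex.I * Complex.exp (Complex.I * (x : ℂ)) * (ρ.real {y | a y ≤ x} : ℝ) := by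
  set f : ℝ → α → ℂ := fun x y => Complex.I * Complex.exp (Complex.I * (x : ℂ)) *
    ((Ici (a y)).indicator (fun _ => (1 : ℝ)) x : ℝ) with hf
  have hint : Integrable (Function.uncurry f)
      ((volume.restrict (uIoc 0 (2 * Real.pi))).prod ρ) := by
    have hset : NullMeasurableSet {p : ℝ × α | a p.2 ≤ p.1}
        ((volume.restrict (uIoc 0 (2 * Real.pi))).prod ρ) :=
      nullMeasurableSet_le ha.comp_snd measurable_fst.aemeasurable
    have hm : AEStronglyMeasurable ({p : ℝ × α | a p.2 ≤ p.1}.indicator fun p =>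
        Complex.I * Complex.exp (Complex.I * (p.1 : ℂ)))
        ((volume.restrict (uIoc 0 (2 * Real.pi))).prod ρ) :=
      AEStronglyMeasurable.indicator₀ (Measurable.aestronglyMeasurable (by fun_prop)) hset
    have heq : Function.uncurry f = {p : ℝ × α | a p.2 ≤ p.1}.indicator fun p =>
        Complex.I * Complex.exp (Complex.I * (p.1 : ℂ)) := by
      ext ⟨x, y⟩
      by_cases h : a y ≤ x <;> simp [hf, indicator, h]
    have : IsFiniteMeasure (volume.restrict (uIoc 0 (2 * Real.pi))) := ⟨by simp [uIoc]⟩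
    rw [heq]
    refine Integrable.of_bound hm 1 (ae_of_all _ fun p => ?_)
    exact (norm_indicator_le_norm_self _ _).trans (norm_I_mul_exp _).le
  have h1 : ∫ y, Complex.exp (Complex.I * (a y : ℂ)) ∂ρ =
      ∫ y, (1 - ∫ x in (0 : ℝ)..2 * Real.pi, f x y) ∂ρ :=
    integral_congr_ae (har.mono fun y hy => exp_I_mul_eq hy)
  have hint2 : Integrable (fun y => ∫ x in (0 : ℝ)..2 * Real.pi, f x y) ρ := by
    simp only [intervalIntegral.intervalIntegral_eq_integral_uIoc]
    exact hint.integral_prod_right.smul _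
  rw [h1, integral_sub (integrable_const _) hint2, ← intervalIntegral_integral_swap hint,
    integral_const, Complex.real_smul, mul_one]
  congr 1
  refine intervalIntegral.integral_congr fun x _ => ?_
  simp only [hf]
  rw [integral_const_mul, integral_complex_ofReal]
  congr 2
  have h2 : (fun y => (Ici (a y)).indicator (fun _ => (1 : ℝ)) x) =
      {y | a y ≤ x}.indicator fun _ => 1 := by
    ext y
    by_cases h : a y ≤ x <;> simp [indicator, h]
  rw [h2, integral_indicator₀ (nullMeasurableSet_le ha measurable_const.aemeasurable)]
  simp

/-! ### Quantiles and the limit curve -/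

section Quantile

variable {ν : Measure ℝ} [IsProbabilityMeasure ν]

lemma circleCdf_eq_cdf (hν : ν (Ico 0 (2 * Real.pi))ᶜ = 0) (x : ℝ) :
    circleCdf ν x = cdf ν x := by
  rw [cdf_eq_real, circleCdf]
  refine measureReal_congr ?_
  filter_upwards [compl_mem_ae_iff.2 hν] with y hy
  rw [compl_compl] at hy
  exact propext ⟨fun h => h.2, fun h => ⟨hy.1, h⟩⟩

lemma monotone_circleCdf (ν : Measure ℝ) [IsProbabilityMeasure ν] : Monotone (circleCdf ν) :=
  fun _ _ h => measureReal_mono (Icc_subset_Icc_right h)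

lemma circleCdf_le_one (ν : Measure ℝ) [IsProbabilityMeasure ν] (x : ℝ) : circleCdf ν x ≤ 1 :=
  measureReal_le_one

lemma circleCdf_nonneg (ν : Measure ℝ) (x : ℝ) : 0 ≤ circleCdf ν x :=
  measureReal_nonneg

lemma circleCdf_two_pi (hν : ν (Ico 0 (2 * Real.pi))ᶜ = 0) : circleCdf ν (2 * Real.pi) = 1 := by
  have h : ν.real (Ico 0 (2 * Real.pi)) = 1 := by
    rw [← probReal_univ (μ := ν)]
    refine measureReal_congr ?_
    filter_upwards [compl_mem_ae_iff.2 hν] with y hy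
    rw [compl_compl] at hy
    exact propext ⟨fun _ => trivial, fun _ => hy⟩
  exact le_antisymm (circleCdf_le_one ν _) (h ▸ measureReal_mono Ico_subset_Icc_self)

/-- The infimum is attained because the distribution function is right continuous. The bound `u ≤ 1`
keeps the set nonempty; otherwise `sInf ∅ = 0` would break the equivalence. -/
lemma circleQuantile_le_iff (hν : ν (Ico 0 (2 * Real.pi))ᶜ = 0) {u x : ℝ} (hu : u ≤ 1)
    (hx : 0 ≤ x) : circleQuantile ν u ≤ x ↔ u ≤ circleCdf ν x := by
  have hbdd : BddBelow {x : ℝ | 0 ≤ x ∧ u ≤ circleCdf ν x} := ⟨0, fun y hy => hy.1⟩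
  have hne : {x : ℝ | 0 ≤ x ∧ u ≤ circleCdf ν x}.Nonempty :=
    ⟨2 * Real.pi, by positivity, (circleCdf_two_pi hν).symm ▸ hu⟩
  refine ⟨fun h => ?_, fun h => csInf_le hbdd ⟨hx, h⟩⟩
  have hright : Tendsto (circleCdf ν) (𝓝[>] x) (𝓝 (circleCdf ν x)) := by
    have : circleCdf ν = cdf ν := funext (circleCdf_eq_cdf hν)
    rw [this]
    exact ((cdf ν).right_continuous x).mono_left (nhdsWithin_mono _ Ioi_subset_Ici_self)
  refine ge_of_tendsto hright ?_
  filter_upwards [self_mem_nhdsWithin] with y hy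
  obtain ⟨z, hz, hzy⟩ := exists_lt_of_csInf_lt hne (h.trans_lt hy)
  exact hz.2.trans (monotone_circleCdf ν hzy.le)

lemma circleQuantile_mem (hν : ν (Ico 0 (2 * Real.pi))ᶜ = 0) {u : ℝ} (hu : u ≤ 1) :
    circleQuantile ν u ∈ Icc 0 (2 * Real.pi) :=
  ⟨Real.sInf_nonneg fun _ hy => hy.1, (circleQuantile_le_iff hν hu (by positivity)).2
    ((circleCdf_two_pi hν).symm ▸ hu)⟩

lemma monotoneOn_circleQuantile (hν : ν (Ico 0 (2 * Real.pi))ᶜ = 0) :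
    MonotoneOn (circleQuantile ν) (Iic 1) := fun _ hu _ hv huv =>
  (circleQuantile_le_iff hν hu (circleQuantile_mem hν hv).1).2
    (huv.trans ((circleQuantile_le_iff hν hv (circleQuantile_mem hν hv).1).1 le_rfl))

lemma curveZ_eq_arcCurve (hν : ν (Ico 0 (2 * Real.pi))ᶜ = 0) {s : ℝ} (hs : s ∈ Icc 0 1) :
    curveZ ν s = arcCurve (circleCdf ν) s := by
  have hsub : Ioc 0 s ⊆ Iic 1 := fun u hu => hu.2.trans hs.2
  have hmeas : AEMeasurable (circleQuantile ν) (volume.restrict (Ioc 0 s)) :=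
    aemeasurable_restrict_of_monotoneOn measurableSet_Ioc
      ((monotoneOn_circleQuantile hν).mono hsub)
  rw [curveZ, intervalIntegral.integral_of_le hs.1, integral_exp_I_mul _ hmeas
    ((ae_restrict_mem measurableSet_Ioc).mono fun u hu => circleQuantile_mem hν (hsub hu)),
    arcCurve]
  congr 1
  · simp [hs.1]
  · refine intervalIntegral.integral_congr fun x hx => ?_
    rw [uIcc_of_le (by positivity)] at hx
    have hset : {u | circleQuantile ν u ≤ x} ∩ Ioc 0 s = Ioc 0 (min s (circleCdf ν x)) := by
      ext u
      simp only [mem_inter_iff, mem_ofPred_eq, mem_Ioc, le_min_iff]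
      refine ⟨fun ⟨h1, h2, h3⟩ => ⟨h2, h3, ?_⟩, fun ⟨h1, h2, h3⟩ => ⟨?_, h1, h2⟩⟩
      · exact (circleQuantile_le_iff hν (h3.trans hs.2) hx.1).1 h1
      · exact (circleQuantile_le_iff hν (h2.trans hs.2) hx.1).2 h3
    have hr : (volume.restrict (Ioc 0 s)).real {u | circleQuantile ν u ≤ x} =
        min s (circleCdf ν x) := by
      rw [measureReal_def, Measure.restrict_apply₀ (nullMeasurableSet_le hmeas aemeasurable_const),
        hset, ← measureReal_def, Real.volume_real_Ioc_of_le (le_min hs.1 (circleCdf_nonneg ν x)),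
        sub_zero]
    simp only [hr]

/-- Both sides are the same `arcCurve`: `ν` restricted to `[0, θ]` gives `[0, x]` the mass `min (F
θ) (F x)`. -/
lemma setIntegral_exp_eq_curveZ (hν : ν (Ico 0 (2 * Real.pi))ᶜ = 0) {θ : ℝ}
    (hθ : θ ∈ Icc 0 (2 * Real.pi)) :
    ∫ t in Icc (0 : ℝ) θ, Complex.exp (Complex.I * (t : ℂ)) ∂ν =
      curveZ ν (circleCdf ν θ) := by
  rw [curveZ_eq_arcCurve hν ⟨circleCdf_nonneg ν θ, circleCdf_le_one ν θ⟩, arcCurve,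
    integral_exp_I_mul (a := fun t => t) _ aemeasurable_id
      ((ae_restrict_mem measurableSet_Icc).mono fun t ht => ⟨ht.1, ht.2.trans hθ.2⟩)]
  congr 1
  · simp [circleCdf]
  · refine intervalIntegral.integral_congr fun x hx => ?_
    have hr : (ν.restrict (Icc 0 θ)).real {t | t ≤ x} = min (circleCdf ν θ) (circleCdf ν x) := by
      rw [← (monotone_circleCdf ν).map_min, circleCdf, measureReal_def,
        Measure.restrict_apply (measurableSet_le measurable_id' measurable_const), ← measureReal_def]
      congr 1
      ext t
      simp only [mem_inter_iff, mem_ofPred_eq, mem_Icc, le_min_iff]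
      tauto
    simp only [hr]

end Quantile

/-- `|min s G - min r H| ≤ |s - r| + |G - H|`, integrated over an interval of length `2π`; the extra
`1` comes from the leading term `s`. -/
lemma norm_arcCurve_sub_le {G H : ℝ → ℝ} (hG : Monotone G) (hH : Monotone H) (s r : ℝ) :
    ‖arcCurve G s - arcCurve H r‖ ≤
      (1 + 2 * Real.pi) * |s - r| + ∫ x in (0 : ℝ)..2 * Real.pi, |G x - H x| := by
  have hmG : Monotone fun x => min s (G x) := monotone_const.min hG
  have hmH : Monotone fun x => min r (H x) := monotone_const.min hH
  have heq : arcCurve G s - arcCurve H r = ((s - r : ℝ) : ℂ) - ∫ x in (0 : ℝ)..2 * Real.pi,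
      Complex.I * Complex.exp (Complex.I * (x : ℂ)) * ((min s (G x) - min r (H x) : ℝ) : ℂ) := by
    have hsplit := intervalIntegral.integral_sub (a := 0) (b := 2 * Real.pi) (μ := volume)
      (intervalIntegrable_I_mul_exp_mul hmG.intervalIntegrable)
      (intervalIntegrable_I_mul_exp_mul hmH.intervalIntegrable)
    simp only [Complex.ofReal_sub (min s _), mul_sub, hsplit, arcCurve]
    push_cast
    ring
  have hbound : ‖∫ x in (0 : ℝ)..2 * Real.pi, Complex.I * Complex.exp (Complex.I * (x : ℂ)) *
      ((min s (G x) - min r (H x) : ℝ) : ℂ)‖ ≤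
      ∫ x in (0 : ℝ)..2 * Real.pi, (|s - r| + |G x - H x|) := by
    refine intervalIntegral.norm_integral_le_of_norm_le (by positivity) (ae_of_all _ fun x _ => ?_)
      (intervalIntegrable_const.add
        (hG.intervalIntegrable.sub hH.intervalIntegrable).abs)
    rw [norm_mul, norm_I_mul_exp, one_mul, Complex.norm_real, Real.norm_eq_abs]
    exact (abs_min_sub_min_le_max _ _ _ _).trans
      (max_le_add_of_nonneg (abs_nonneg _) (abs_nonneg _))
  rw [intervalIntegral.integral_add intervalIntegrable_const
    (hG.intervalIntegrable.sub hH.intervalIntegrable).abs, intervalIntegral.integral_const,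
    smul_eq_mul, sub_zero] at hbound
  rw [heq]
  refine (norm_sub_le _ _).trans ?_
  rw [Complex.norm_real, Real.norm_eq_abs]
  linarith

/-! ### Sums of finitely many steps -/

/-- The cumulative distribution function of the measure `∑ j, p j • δ_{a j}`. -/
def stepCdf {ι : Type*} [Fintype ι] (a p : ι → ℝ) (x : ℝ) : ℝ :=
  ∑ j, (Ici (a j)).indicator (fun _ => p j) x

lemma monotone_stepCdf {ι : Type*} [Fintype ι] (a : ι → ℝ) {p : ι → ℝ} (hp : ∀ j, 0 ≤ p j) :
    Monotone (stepCdf a p) := fun x y hxy => by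
  refine Finset.sum_le_sum fun j _ => ?_
  by_cases hx : a j ≤ x
  · simp [indicator, hx, hx.trans hxy]
  · by_cases hy : a j ≤ y <;> simp [indicator, hx, hy, hp j]

lemma stepCdf_nonneg {ι : Type*} [Fintype ι] (a : ι → ℝ) {p : ι → ℝ} (hp : ∀ j, 0 ≤ p j)
    (x : ℝ) : 0 ≤ stepCdf a p x :=
  Finset.sum_nonneg fun j _ => indicator_nonneg (fun _ _ => hp j) x

lemma stepCdf_le {ι : Type*} [Fintype ι] (a : ι → ℝ) {p : ι → ℝ} (hp : ∀ j, 0 ≤ p j)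
    (x : ℝ) : stepCdf a p x ≤ ∑ j, p j :=
  Finset.sum_le_sum fun j _ => indicator_le_self' (fun _ _ => hp j) x

lemma stepCdf_comp_perm {ι : Type*} [Fintype ι] (a p : ι → ℝ) (σ : Equiv.Perm ι) :
    stepCdf (fun j => a (σ j)) (fun j => p (σ j)) = stepCdf a p :=
  funext fun x => Equiv.sum_comp σ fun j => (Ici (a j)).indicator (fun _ => p j) x

/-- A sum of steps with weights `c j ∈ [0, 1]` which fill the steps in the order of their
directions is a point of the curve of the steps. -/
lemma sum_exp_eq_arcCurve {ι : Type*} [Fintype ι] {a p c : ι → ℝ}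
    (ha : ∀ j, a j ∈ Icc 0 (2 * Real.pi)) (hp : ∀ j, 0 ≤ p j) (hc : ∀ j, c j ∈ Icc 0 1)
    (hsort : ∀ x, (∀ j, c j ≠ 0 → a j ≤ x) ∨ ∀ j, a j ≤ x → c j = 1) :
    ∑ j, ((c j * p j : ℝ) : ℂ) * Complex.exp (Complex.I * (a j : ℂ)) =
      arcCurve (stepCdf a p) (∑ j, c j * p j) := by
  -- The length travelled in directions at most `x` is the whole travelled length in the first case
  -- of `hsort`, and the whole available length `stepCdf a p x` in the second.
  have hmin : ∀ x, min (∑ j, c j * p j) (stepCdf a p x) =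
      ∑ j, c j * p j * (Ici (a j)).indicator (fun _ => (1 : ℝ)) x := by
    intro x
    rcases hsort x with h | h
    · have h1 : ∀ j, c j * p j * (Ici (a j)).indicator (fun _ => (1 : ℝ)) x = c j * p j := by
        intro j
        by_cases hj : c j = 0
        · simp [hj]
        · simp [indicator, h j hj]
      simp only [h1]
      refine min_eq_left (Finset.sum_le_sum fun j _ => ?_)
      by_cases hj : c j = 0
      · simpa [hj] using indicator_nonneg (fun _ _ => hp j) x
      · simpa [indicator, h j hj] using mul_le_of_le_one_left (hp j) (hc j).2
    · have h1 : ∀ j, c j * p j * (Ici (a j)).indicator (fun _ => (1 : ℝ)) x =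
          (Ici (a j)).indicator (fun _ => p j) x := by
        intro j
        by_cases hj : a j ≤ x
        · simp [indicator, hj, h j hj]
        · simp [indicator, hj]
      simp only [h1]
      refine min_eq_right (Finset.sum_le_sum fun j _ => ?_)
      by_cases hj : a j ≤ x
      · simp [indicator, hj, h j hj]
      · simpa [indicator, hj] using mul_nonneg (hc j).1 (hp j)
  have hi : ∀ j, IntervalIntegrable (fun x : ℝ => ((c j * p j : ℝ) : ℂ) *
      (Complex.I * Complex.exp (Complex.I * (x : ℂ)) *
        ((Ici (a j)).indicator (fun _ => (1 : ℝ)) x : ℝ))) volume 0 (2 * Real.pi) := fun j =>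
    (intervalIntegrable_I_mul_exp_mul (intervalIntegrable_indicator_Ici _ _ _)).const_mul _
  have hint : ∫ x in (0 : ℝ)..2 * Real.pi, Complex.I * Complex.exp (Complex.I * (x : ℂ)) *
      (min (∑ j, c j * p j) (stepCdf a p x) : ℝ) =
      ∑ j, ((c j * p j : ℝ) : ℂ) * ∫ x in (0 : ℝ)..2 * Real.pi,
        Complex.I * Complex.exp (Complex.I * (x : ℂ)) *
          ((Ici (a j)).indicator (fun _ => (1 : ℝ)) x : ℝ) := by
    simp only [← intervalIntegral.integral_const_mul]
    rw [← intervalIntegral.integral_finsetSum fun j _ => hi j]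
    refine intervalIntegral.integral_congr fun x _ => ?_
    simp only [hmin, Complex.ofReal_sum, Finset.mul_sum]
    refine Finset.sum_congr rfl fun j _ => ?_
    push_cast
    ring
  rw [arcCurve, hint, Complex.ofReal_sum, ← Finset.sum_sub_distrib]
  refine Finset.sum_congr rfl fun j _ => ?_
  rw [exp_I_mul_eq (ha j)]
  ring

/-- The portion in `[0, 1]` of the `j`-th step which is travelled at time `t`. -/
def travelled (t : ℝ) (j : ℕ) : ℝ := max 0 (min 1 (t - j))

lemma travelled_mem (t : ℝ) (j : ℕ) : travelled t j ∈ Icc 0 1 :=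
  ⟨le_max_left _ _, max_le zero_le_one (min_le_left _ _)⟩

lemma continuous_travelled (j : ℕ) : Continuous fun t => travelled t j := by
  unfold travelled
  fun_prop

lemma travelled_of_le {t : ℝ} {j : ℕ} (h : t ≤ j) : travelled t j = 0 :=
  max_eq_left ((min_le_right _ _).trans (by linarith))

lemma travelled_of_add_one_le {t : ℝ} {j : ℕ} (h : (j : ℝ) + 1 ≤ t) : travelled t j = 1 := by
  rw [travelled, min_eq_left (by linarith), max_eq_right zero_le_one]

lemma interpSum_eq_sum {n : ℕ} (w : Fin n → ℂ) {t : ℝ} (ht : 0 ≤ t) :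
    interpSum w t = ∑ j : Fin n, (travelled t j : ℂ) * w j := by
  have h0 := Nat.floor_le ht
  have h1 := Nat.lt_floor_add_one t
  simp only [interpSum, partialSum, Finset.sum_filter]
  rw [← Finset.sum_sub_distrib, Finset.mul_sum, ← Finset.sum_add_distrib]
  refine Finset.sum_congr rfl fun j _ => ?_
  rcases lt_trichotomy (j : ℕ) ⌊t⌋₊ with h | h | h
  · have h2 : ((j : ℕ) : ℝ) + 1 ≤ ⌊t⌋₊ := by exact_mod_cast h
    rw [travelled_of_add_one_le (h2.trans h0)]
    simp [h, h.trans (Nat.lt_succ_self _)]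
  · have h2 : travelled t j = t - ⌊t⌋₊ := by
      rw [travelled, h, min_eq_right (by linarith), max_eq_right (by linarith)]
    rw [h2]
    simp [h]
  · have h2 : (⌊t⌋₊ : ℝ) + 1 ≤ (j : ℕ) := by exact_mod_cast h
    rw [travelled_of_le (h1.le.trans h2)]
    simp [h.not_gt, h.not_ge]

lemma interpSum_natCast {n : ℕ} (w : Fin n → ℂ) (k : ℕ) : interpSum w k = partialSum w k := by
  simp [interpSum]

/-- If step `i` had begun with direction beyond `x` while step `j`, of direction at most `x`, was
unfinished, sorting would give `j < i`, yet `i < t < j + 1`. This is the hypothesis `hsort` of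
`sum_exp_eq_arcCurve`. -/
lemma travelled_sorted {n : ℕ} {a : Fin n → ℝ} (ha : Monotone a) (t x : ℝ) :
    (∀ j : Fin n, travelled t j ≠ 0 → a j ≤ x) ∨ ∀ j : Fin n, a j ≤ x → travelled t j = 1 := by
  by_contra! h
  obtain ⟨⟨i, hi, hix⟩, j, hj, hjt⟩ := h
  have hji : j < i := ha.reflect_lt (hj.trans_lt hix)
  have h1 : (i : ℕ) < t := lt_of_not_ge fun h => hi (travelled_of_le h)
  have h2 : t < (j : ℕ) + 1 := lt_of_not_ge fun h => hjt (travelled_of_add_one_le h)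
  have h3 : ((j : ℕ) : ℝ) + 1 ≤ (i : ℕ) := by exact_mod_cast hji
  linarith

/-- The points of the rescaled polygonal line of sorted steps. -/
lemma inv_smul_interpSum_eq_arcCurve {n : ℕ} {v : Fin n → ℂ}
    (hv : Monotone fun j => argPos (v j)) {r : ℝ} (hr : 0 ≤ r) {t : ℝ} (ht : 0 ≤ t) :
    r⁻¹ • interpSum v t = arcCurve (stepCdf (fun j => argPos (v j)) fun j => ‖v j‖ / r)
      (∑ j : Fin n, travelled t j * (‖v j‖ / r)) := by
  rw [← sum_exp_eq_arcCurve (c := fun j : Fin n => travelled t j)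
    (fun j => ⟨argPos_nonneg _, (argPos_lt _).le⟩)
    (fun j => div_nonneg (norm_nonneg _) hr) (fun j => travelled_mem t j) (travelled_sorted hv t),
    interpSum_eq_sum v ht, Finset.smul_sum]
  refine Finset.sum_congr rfl fun j _ => ?_
  nth_rw 1 [← norm_mul_exp_argPos (v j)]
  rw [Complex.real_smul]
  push_cast
  ring

lemma exists_sum_travelled_eq {n : ℕ} {p : Fin n → ℝ} {s : ℝ} (hs : s ∈ Icc 0 (∑ j, p j)) :
    ∃ t ∈ Icc 0 (n : ℝ), ∑ j : Fin n, travelled t j * p j = s := by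
  have hcont : Continuous fun t => ∑ j : Fin n, travelled t j * p j :=
    continuous_finsetSum _ fun j _ => (continuous_travelled j).mul continuous_const
  have h0 : ∑ j : Fin n, travelled 0 j * p j = 0 :=
    Finset.sum_eq_zero fun j _ => by rw [travelled_of_le (Nat.cast_nonneg _), zero_mul]
  have h1 : ∑ j : Fin n, travelled n j * p j = ∑ j, p j :=
    Finset.sum_congr rfl fun j _ => by
      rw [travelled_of_add_one_le (by exact_mod_cast j.2), one_mul]
  have := intermediate_value_Icc (Nat.cast_nonneg n) hcont.continuousOn
  simp only [h0, h1] at this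
  exact this hs

/-- The Hausdorff distance between a rescaled polygonal line of sorted steps and the curve of a
measure is controlled by the `L¹` distance of the cumulative distribution functions. -/
lemma hausdorffDist_polygonalLine_le {ν : Measure ℝ} [IsProbabilityMeasure ν]
    (hν : ν (Ico 0 (2 * Real.pi))ᶜ = 0) {n : ℕ} {v : Fin n → ℂ}
    (hv : Monotone fun j => argPos (v j)) {r : ℝ} (hr : 0 ≤ r) :
    Metric.hausdorffDist (r⁻¹ • polygonalLine v) (curveB ν) ≤
      (1 + 2 * Real.pi) * |∑ j, ‖v j‖ / r - 1| + ∫ x in (0 : ℝ)..2 * Real.pi,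
        |stepCdf (fun j => argPos (v j)) (fun j => ‖v j‖ / r) x - circleCdf ν x| := by
  have hp : ∀ j, 0 ≤ ‖v j‖ / r := fun j => div_nonneg (norm_nonneg _) hr
  have hsum : 0 ≤ ∑ j, ‖v j‖ / r := Finset.sum_nonneg fun j _ => hp j
  -- Points of the two curves are paired by arc length, with a mismatch of at most the error in
  -- total length.
  have key : ∀ t, 0 ≤ t → ∀ s ∈ Icc (0 : ℝ) 1,
      |∑ j : Fin n, travelled t j * (‖v j‖ / r) - s| ≤ |∑ j, ‖v j‖ / r - 1| →
      dist (r⁻¹ • interpSum v t) (curveZ ν s) ≤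
      (1 + 2 * Real.pi) * |∑ j, ‖v j‖ / r - 1| + ∫ x in (0 : ℝ)..2 * Real.pi,
        |stepCdf (fun j => argPos (v j)) (fun j => ‖v j‖ / r) x - circleCdf ν x| := by
    intro t ht s hs hts
    rw [inv_smul_interpSum_eq_arcCurve hv hr ht, curveZ_eq_arcCurve hν hs, dist_eq_norm]
    refine (norm_arcCurve_sub_le (monotone_stepCdf _ hp) (monotone_circleCdf ν) _ _).trans ?_
    gcongr
  refine Metric.hausdorffDist_le_of_mem_dist ?_ ?_ ?_
  · have : 0 ≤ ∫ x in (0 : ℝ)..2 * Real.pi,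
        |stepCdf (fun j => argPos (v j)) (fun j => ‖v j‖ / r) x - circleCdf ν x| :=
      intervalIntegral.integral_nonneg (by positivity) fun x _ => abs_nonneg _
    positivity
  · rintro _ ⟨_, ⟨t, ht, rfl⟩, rfl⟩
    have h0 : 0 ≤ ∑ j : Fin n, travelled t j * (‖v j‖ / r) :=
      Finset.sum_nonneg fun j _ => mul_nonneg (travelled_mem t j).1 (hp j)
    have h1 : ∑ j : Fin n, travelled t j * (‖v j‖ / r) ≤ ∑ j, ‖v j‖ / r :=
      Finset.sum_le_sum fun j _ => mul_le_of_le_one_left (hp j) (travelled_mem t j).2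
    -- The limit curve has length `1`: any excess is paired with its endpoint.
    refine ⟨_, ⟨min (∑ j : Fin n, travelled t j * (‖v j‖ / r)) 1,
      ⟨le_min h0 zero_le_one, min_le_right _ _⟩, rfl⟩,
      key t ht.1 _ ⟨le_min h0 zero_le_one, min_le_right _ _⟩ ?_⟩
    rcases le_total (∑ j : Fin n, travelled t j * (‖v j‖ / r)) 1 with h | h
    · simp [min_eq_left h]
    · rw [min_eq_right h, abs_of_nonneg (by linarith), abs_of_nonneg (by linarith)]
      linarith
  · rintro _ ⟨s, hs, rfl⟩
    obtain ⟨t, ht, hts⟩ := exists_sum_travelled_eq (p := fun j => ‖v j‖ / r)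
      (s := min s (∑ j, ‖v j‖ / r)) ⟨le_min hs.1 hsum, min_le_right _ _⟩
    refine ⟨_, smul_mem_smul_set ⟨t, ht, rfl⟩, ?_⟩
    rw [dist_comm]
    refine key t ht.1 s hs ?_
    rw [hts]
    rcases le_total s (∑ j, ‖v j‖ / r) with h | h
    · simp [min_eq_left h]
    · have hs1 := hs.2
      rw [min_eq_right h, abs_of_nonpos (by linarith), abs_of_nonpos (by linarith)]
      linarith

/-! ### Steps of argument at most `θ` -/

lemma argCount_le {n : ℕ} (w : Fin n → ℂ) (θ : ℝ) : argCount w θ ≤ n := by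
  simpa [argCount] using Finite.card_subtype_le fun i : Fin n => argPos (w i) ≤ θ

/-- The first `argCount w θ` indices and the indices `j` with `argPos (v j) ≤ θ` are initial
segments of equal cardinality, hence equal. -/
lemma partialSum_argCount {n : ℕ} {w v : Fin n → ℂ} (h : IsArgSorting w v) (θ : ℝ) :
    partialSum v (argCount w θ) = ∑ i, {z | argPos z ≤ θ}.indicator (fun z => z) (w i) := by
  obtain ⟨⟨σ, hσ⟩, hmono⟩ := h
  have hcount : argCount w θ = (Finset.univ.filter fun j => argPos (v j) ≤ θ).card := by
    rw [← Fintype.card_subtype, ← Nat.card_eq_fintype_card, argCount]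
    exact (Nat.card_congr (σ.subtypeEquiv fun j => by rw [hσ])).symm
  have hle := argCount_le w θ
  have hcard : (Finset.univ.filter fun j : Fin n => (j : ℕ) < argCount w θ).card =
      argCount w θ := by
    rw [Fin.card_filter_val_lt, min_eq_right hle]
  have hset : (Finset.univ.filter fun j : Fin n => (j : ℕ) < argCount w θ) =
      Finset.univ.filter fun j => argPos (v j) ≤ θ := by
    by_cases hsub : (Finset.univ.filter fun j : Fin n => (j : ℕ) < argCount w θ) ⊆
        Finset.univ.filter fun j => argPos (v j) ≤ θ
    · exact Finset.eq_of_subset_of_card_le hsub (by rw [hcard, hcount])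
    · obtain ⟨i, hi, hi'⟩ := Finset.not_subset.1 hsub
      simp only [Finset.mem_filter, Finset.mem_univ, true_and, not_le] at hi hi'
      refine (Finset.eq_of_subset_of_card_le (fun j hj => ?_) (by rw [hcard, hcount])).symm
      simp only [Finset.mem_filter, Finset.mem_univ, true_and] at hj ⊢
      have hji : j < i := hmono.reflect_lt (hj.trans_lt hi')
      exact lt_trans hji hi
  rw [partialSum, hset, ← Equiv.sum_comp σ, Finset.sum_filter]
  refine Finset.sum_congr rfl fun j _ => ?_
  simp [indicator, hσ j]

/-! ### Convergence of distribution functions and the strong law -/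

lemma tendsto_of_tendsto_rat {G : ℕ → ℝ → ℝ} {F : ℝ → ℝ} (hG : ∀ n, Monotone (G n))
    (h : ∀ q : ℚ, Tendsto (fun n => G n q) atTop (𝓝 (F q))) {x : ℝ} (hx : ContinuousAt F x) :
    Tendsto (fun n => G n x) atTop (𝓝 (F x)) := by
  refine tendsto_order.2 ⟨fun a ha => ?_, fun a ha => ?_⟩
  · obtain ⟨l, u, hlu, hsub⟩ := mem_nhds_iff_exists_Ioo_subset.1 (hx.eventually_const_lt ha)
    obtain ⟨q, hlq, hqx⟩ := exists_rat_btwn hlu.1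
    have hq : a < F q := hsub ⟨hlq, hqx.trans hlu.2⟩
    filter_upwards [(h q).eventually_const_lt hq] with n hn using hn.trans_le (hG n hqx.le)
  · obtain ⟨l, u, hlu, hsub⟩ := mem_nhds_iff_exists_Ioo_subset.1 (hx.eventually_lt_const ha)
    obtain ⟨q, hxq, hqu⟩ := exists_rat_btwn hlu.2
    have hq : F q < a := hsub ⟨hlu.1.trans hxq, hqu⟩
    filter_upwards [(h q).eventually_lt_const hq] with n hn using (hG n hxq.le).trans_lt hn

lemma tendsto_integral_abs_sub {G : ℕ → ℝ → ℝ} {F : ℝ → ℝ} {L : ℕ → ℝ} {l : ℝ}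
    (hG : ∀ n, Monotone (G n)) (hF : Monotone F) (hG0 : ∀ n x, 0 ≤ G n x)
    (hGL : ∀ n x, G n x ≤ L n) (hL : Tendsto L atTop (𝓝 l))
    (hF0 : ∀ x, 0 ≤ F x) (hF1 : ∀ x, F x ≤ 1)
    (h : ∀ q : ℚ, Tendsto (fun n => G n q) atTop (𝓝 (F q))) (a b : ℝ) :
    Tendsto (fun n => ∫ x in a..b, |G n x - F x|) atTop (𝓝 0) := by
  have key := intervalIntegral.tendsto_integral_filter_of_dominated_convergence
    (μ := volume) (a := a) (b := b) (l := atTop) (F := fun n x => |G n x - F x|)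
    (f := fun _ => (0 : ℝ)) (fun _ => l + 2) ?_ ?_ intervalIntegrable_const ?_
  · simpa using key
  · exact Eventually.of_forall fun n =>
      ((hG n).measurable.sub hF.measurable).norm.aestronglyMeasurable
  -- Eventually `0 ≤ G n x ≤ L n < l + 1`, and `0 ≤ F x ≤ 1`, so `l + 2` dominates.
  · filter_upwards [hL.eventually_lt_const (lt_add_one l)] with n hn
    refine ae_of_all _ fun x _ => ?_
    rw [Real.norm_eq_abs, abs_abs, abs_le]
    constructor <;> linarith [hG0 n x, hGL n x, hF0 x, hF1 x]
  -- A monotone function has countably many discontinuities, a Lebesgue null set.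
  · filter_upwards [hF.countable_not_continuousAt.ae_notMem volume] with x hx _
    have hx' : ContinuousAt F x := not_not.1 hx
    simpa using ((tendsto_of_tendsto_rat hG h hx').sub_const (F x)).abs

lemma ae_tendsto_average {Ω : Type*} [MeasurableSpace Ω] {P : Measure Ω} [IsProbabilityMeasure P]
    {μ : Measure ℂ} {W : ℕ → Ω → ℂ} (hlaw : ∀ i, HasLaw (W i) μ P) (hindep : iIndepFun W P)
    {E : Type*} [NormedAddCommGroup E] [NormedSpace ℝ E] [CompleteSpace E] [MeasurableSpace E]
    [BorelSpace E] {f : ℂ → E} (hf : Measurable f) (hfi : Integrable f μ) :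
    ∀ᵐ ω ∂P, Tendsto (fun n : ℕ => (n : ℝ)⁻¹ • ∑ i : Fin n, f (W i ω)) atTop
      (𝓝 (∫ z, f z ∂μ)) := by
  have hident : ∀ i, IdentDistrib (W i) (W 0) P P := fun i =>
    ⟨(hlaw i).aemeasurable, (hlaw 0).aemeasurable, by rw [(hlaw i).map_eq, (hlaw 0).map_eq]⟩
  have hm : AEStronglyMeasurable f (P.map (W 0)) := by
    rw [(hlaw 0).map_eq]
    exact hfi.aestronglyMeasurable
  have h := strong_law_ae (μ := P) (fun i ω => f (W i ω))
    (((hlaw 0).map_eq ▸ hfi : Integrable f (P.map (W 0))).comp_aemeasurable (hlaw 0).aemeasurable)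
    (fun i j hij => (hindep.indepFun hij).comp hf hf) (fun i => (hident i).comp hf)
  have hI : ∫ ω, f (W 0 ω) ∂P = ∫ z, f z ∂μ := by
    rw [← integral_map (hlaw 0).aemeasurable hm, (hlaw 0).map_eq]
  filter_upwards [h] with ω hω
  rw [hI] at hω
  simpa only [Finset.sum_range] using hω

end SortedPolygon

end

theorem mainTheorem8 {Ω : Type*} [MeasurableSpace Ω] (P : Measure Ω) [IsProbabilityMeasure P]
    (μ : Measure ℂ) [IsProbabilityMeasure μ]
    -- `μ` is centred and is not the Dirac mass at `0`
    (hint : Integrable (fun z : ℂ => z) μ) (hmean : ∫ z, z ∂μ = 0)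
    (hμ : μ ≠ Measure.dirac 0)
    -- `W 0, W 1, …` are i.i.d. with law `μ`
    (W : ℕ → Ω → ℂ) (hlaw : ∀ i, HasLaw (W i) μ P) (hindep : iIndepFun W P)
    -- `What n` is the list `W 0, …, W (n - 1)` sorted by argument, ties in any (random) order
    (What : (n : ℕ) → Ω → Fin n → ℂ)
    (hWhat : ∀ n, ∀ᵐ ω ∂P, SortedPolygon.IsArgSorting (fun i : Fin n => W i ω) (What n ω)) :
    (∀ᵐ ω ∂P, Tendsto
      (fun n : ℕ => Metric.hausdorffDist
        (((n : ℝ) * SortedPolygon.meanModulus μ)⁻¹ • SortedPolygon.polygonalLine (What n ω))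
        (SortedPolygon.curveB (SortedPolygon.lawK μ)))
      atTop (𝓝 0)) ∧
    (∀ θ ∈ Ico (0 : ℝ) (2 * Real.pi),
      (∀ᵐ ω ∂P, Tendsto
        (fun n : ℕ =>
          SortedPolygon.interpSum (What n ω)
              (SortedPolygon.argCount (fun i : Fin n => W i ω) θ : ℝ) /
            (((n : ℝ) * SortedPolygon.meanModulus μ : ℝ) : ℂ))
        atTop
        (𝓝 (∫ t in Icc (0 : ℝ) θ, Complex.exp (Complex.I * (t : ℂ)) ∂(SortedPolygon.lawK μ)))) ∧
      ∫ t in Icc (0 : ℝ) θ, Complex.exp (Complex.I * (t : ℂ)) ∂(SortedPolygon.lawK μ) =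
        SortedPolygon.curveZ (SortedPolygon.lawK μ)
          (SortedPolygon.circleCdf (SortedPolygon.lawK μ) θ)) := by
  open SortedPolygon in
  have hM := meanModulus_pos hint hμ
  have hprob := isProbabilityMeasure_lawK hint hμ
  have hν := lawK_compl_Ico hint
  have hset : ∀ θ : ℝ, MeasurableSet {z | argPos z ≤ θ} := fun θ =>
    measurableSet_le measurable_argPos measurable_const
  refine ⟨?_, fun θ hθ => ⟨?_, setIntegral_exp_eq_curveZ hν ⟨hθ.1, hθ.2.le⟩⟩⟩
  -- Restricting to rational `q` allows a single null set for all of them.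
  · have hcdf : ∀ᵐ ω ∂P, ∀ q : ℚ, Tendsto (fun n : ℕ => (n : ℝ)⁻¹ • ∑ i : Fin n,
        {z | argPos z ≤ q}.indicator (fun z => ‖z‖ / meanModulus μ) (W i ω)) atTop
        (𝓝 (circleCdf (lawK μ) q)) := ae_all_iff.2 fun q => by
      rw [circleCdf_lawK hint]
      exact ae_tendsto_average hlaw hindep ((measurable_norm.div_const _).indicator (hset q))
        ((hint.norm.div_const _).indicator (hset q))
    have hone : ∫ z : ℂ, ‖z‖ / meanModulus μ ∂μ = 1 := by
      rw [integral_div]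
      exact div_self hM.ne'
    have hlen := ae_tendsto_average hlaw hindep (measurable_norm.div_const (meanModulus μ))
      (hint.norm.div_const _)
    rw [hone] at hlen
    filter_upwards [hcdf, hlen, ae_all_iff.2 hWhat] with ω hω1 hω2 hω3
    have hr : ∀ n : ℕ, 0 ≤ (n : ℝ) * meanModulus μ := fun n => by positivity
    set p : (n : ℕ) → Fin n → ℝ := fun n i => ‖W i ω‖ / (n * meanModulus μ) with hp
    set G : ℕ → ℝ → ℝ := fun n => stepCdf (fun i : Fin n => argPos (W i ω)) (p n) with hG
    have hp0 : ∀ n i, 0 ≤ p n i := fun n i => div_nonneg (norm_nonneg _) (hr n)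
    have hL : Tendsto (fun n => ∑ i, p n i) atTop (𝓝 1) := by
      refine hω2.congr fun n => ?_
      rw [smul_eq_mul, Finset.mul_sum]
      refine Finset.sum_congr rfl fun i _ => ?_
      simp only [hp]
      rw [div_mul_eq_div_div_swap, div_eq_inv_mul _ (n : ℝ)]
    have hGq : ∀ q : ℚ, Tendsto (fun n => G n q) atTop (𝓝 (circleCdf (lawK μ) q)) := by
      refine fun q => (hω1 q).congr fun n => ?_
      rw [smul_eq_mul, Finset.mul_sum]
      refine Finset.sum_congr rfl fun i _ => ?_
      by_cases hq : argPos (W i ω) ≤ q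
      · simp only [hp, indicator, mem_ofPred_eq, mem_Ici, hq, if_true]
        rw [div_mul_eq_div_div_swap, div_eq_inv_mul _ (n : ℝ)]
      · simp [indicator, hq]
    have hint0 := tendsto_integral_abs_sub (fun n => monotone_stepCdf _ (hp0 n))
      (monotone_circleCdf (lawK μ)) (fun n => stepCdf_nonneg _ (hp0 n))
      (fun n => stepCdf_le _ (hp0 n)) hL (circleCdf_nonneg _) (circleCdf_le_one _) hGq
      0 (2 * Real.pi)
    have hbound := ((hL.sub_const 1).abs.const_mul (1 + 2 * Real.pi)).add hint0
    rw [sub_self, abs_zero, mul_zero, add_zero] at hbound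
    refine squeeze_zero (fun n => Metric.hausdorffDist_nonneg) (fun n => ?_) hbound
    obtain ⟨⟨σ, hσ⟩, hmono⟩ := hω3 n
    refine (hausdorffDist_polygonalLine_le hν hmono (hr n)).trans_eq ?_
    -- Total length and `stepCdf` ignore the order of the steps, so the i.i.d. steps can replace the
    -- sorted ones, however ties are broken.
    have h1 : ∑ j, ‖What n ω j‖ / (n * meanModulus μ) = ∑ i, p n i := by
      simp only [hσ]
      exact Equiv.sum_comp σ (p n)
    have h2 : stepCdf (fun j => argPos (What n ω j)) (fun j => ‖What n ω j‖ /
        (n * meanModulus μ)) = G n := by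
      simp only [hσ]
      exact stepCdf_comp_perm (fun i : Fin n => argPos (W i ω)) (p n) σ
    rw [h1, h2]
  · have h := ae_tendsto_average hlaw hindep (measurable_id.indicator (hset θ))
      (hint.indicator (hset θ))
    rw [setIntegral_exp_lawK hint]
    filter_upwards [h, ae_all_iff.2 hWhat] with ω hω1 hω2
    refine (hω1.div_const (meanModulus μ : ℂ)).congr fun n => ?_
    rw [interpSum_natCast, partialSum_argCount (hω2 n), Complex.real_smul]
    push_cast
    rw [div_mul_eq_div_div, div_eq_inv_mul _ (n : ℂ)]
    rfl
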